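/- For a subset $A$ of an abelian group and an integer $n\ge 0$ let $nA=\{a_1+\dots+a_n : a_1,\dots,a_n\in A\}$ denote the $n$-fold sumset (so $0A=\{0\}$). All logarithms are to base $2$, and $\varphi$ is Euler's totient function. There are absolute constants $K,c>0$ such that the following holds for every prime $p$ and every multiplicative subgroup $\Gamma\le\mathbb F_p^*$, with $t=|\Gamma|$. 1. For every real $C\ge 1$: if $\varphi(t)\log t\ge\log p$ and $t\le(\log p)^C$, then there is an integer $n$ with $0\le n\le K\,\frac{\log^2 p}{\log\log p}$ and $|n\Gamma|\ge p^{c/C}$. 2. If $t\le\log p$, then there is an integer $n$ with $0\le n\le K\,\varphi(t)^2\log t$ and $$|n\Gamma|\ge\exp\Bigl(c\,\log t\cdot\min\Bigl\{\varphi(t),\frac{\log p}{\log\log p}\Bigr\}\Bigr).$$ (For $p=2$ the group $\Gamma$ is trivial: part 1 is vacuous, and part 2, with the undefined quotient read as $0$, only says $1\ge 1$.) -/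

import Mathlib

/-- The `n`-fold sumset `nA = A + ⋯ + A` (`n` summands, repetitions allowed) of a subset `A` of
an abelian group; in particular `0A = {0}`. -/
def iteratedSumset {G : Type*} [AddCommMonoid G] (n : ℕ) (A : Set G) : Set G :=
  {x | ∃ f : Fin n → G, (∀ i, f i ∈ A) ∧ ∑ i, f i = x}

/-- A multiplicative subgroup of `F_p^*`, viewed as a subset of the field `F_p`. -/
def subgroupSet {p : ℕ} (Γ : Subgroup (ZMod p)ˣ) : Set (ZMod p) :=
  {x | ∃ u : (ZMod p)ˣ, u ∈ Γ ∧ (u : ZMod p) = x}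

/-! Call an integer polynomial small if its degree is at most `s` and its coefficients have total
size at most `N`. If some `h ∈ Γ` is a root modulo `p` of no nonzero small polynomial with `N =
2sH`, then the sums `∑ cᵢ hⁱ` with `1 ≤ i ≤ s` and `0 ≤ cᵢ < H`, padded by ones to exactly `sH`
terms, are distinct (`injective_sum_nsmul_pow`), so the `sH`-fold sumset has at least `H ^ s`
elements.

Such an `h` exists when `s < φ(t)` and `N ^ (3s) < p` (`exists_pow_forall_smallPoly_aeval_ne_zero`).
Otherwise each `x ∈ Γ` is a root of a small `P x`. Let `g` generate `Γ` and let `α` be a complex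
root of an irreducible factor of `P g` vanishing at `g`. By a resultant bound
(`Irreducible.dvd_of_common_root_zmod`), an irreducible factor of `P x` vanishing at `x` divides `P
(x²)(X²)`. Hence every `α ^ 2 ^ k` is a root of some `P x`. There are finitely many such roots, so
`α` is zero or a root of unity. Zero is impossible, and a root of unity makes the factor cyclotomic
up to sign, of degree at least `φ(t) > s`.

Both estimates follow by choosing `s` and `H`. -/

open Polynomial

/-! ### Common roots and resultants -/

/-- Over `ℤ`, an irreducible nonconstant polynomial divides every polynomial with which it shares
a complex root. -/
theorem Irreducible.dvd_of_common_root {F B : ℤ[X]} (hF : Irreducible F) (hd : F.natDegree ≠ 0)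
    {z : ℂ} (hz : aeval z F = 0) (hB : aeval z B = 0) : F ∣ B := by
  -- Gauss's lemma moves the question to `ℚ[X]`, where a Bézout identity would evaluate to `0 = 1`
  -- at `z`.
  have hprim : F.IsPrimitive := hF.isPrimitive hd
  have hFQ : Irreducible (F.map (Int.castRingHom ℚ)) :=
    (IsPrimitive.Int.irreducible_iff_irreducible_map_cast hprim).1 hF
  refine (IsPrimitive.Int.dvd_iff_map_cast_dvd_map_cast F B hprim).2 ?_
  by_contra hnd
  obtain ⟨u, v, huv⟩ := hFQ.coprime_iff_not_dvd.2 hnd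
  have e : ∀ G : ℤ[X], aeval z (G.map (Int.castRingHom ℚ)) = aeval z G := fun G ↦
    aeval_map_algebraMap ℚ z G
  have h1 := congrArg (aeval z) huv
  simp [e, hz, hB] at h1

/-- If an irreducible integer polynomial `F` and an integer polynomial `B` have a common root
modulo `p`, and their sizes are small compared with `p`, then `F` divides `B`. -/
theorem Irreducible.dvd_of_common_root_zmod {p : ℕ} {F B : ℤ[X]} (hF : Irreducible F)
    (hd : F.natDegree ≠ 0) {x : ZMod p} (hFx : aeval x F = 0) (hBx : aeval x B = 0)
    {m : ℕ} (hm : B.natDegree ≤ m) {N : ℝ}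
    (hN : ∀ z : ℂ, ‖aeval z B‖ ≤ N * max 1 ‖z‖ ^ m)
    (hp : (F.map (Int.castRingHom ℂ)).mahlerMeasure ^ m * N ^ F.natDegree < p) : F ∣ B := by
  set ι := Int.castRingHom ℂ
  have hι : Function.Injective ι := Int.cast_injective
  set r := resultant F B F.natDegree m with hr
  have hrp : (p : ℤ) ∣ r := by
    obtain ⟨u, v, -, -, huv⟩ := exists_mul_add_mul_eq_C_resultant F B le_rfl hm (Or.inl hd)
    have := congrArg (aeval x) huv
    rw [map_add, map_mul, map_mul, hFx, hBx, zero_mul, zero_mul, add_zero, aeval_C] at this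
    exact (ZMod.intCast_zmod_eq_zero_iff_dvd r p).1 (by simpa using this.symm)
  -- Using `m` as the formal degree of `B` makes the power of the leading coefficient match the
  -- factors `max 1 ‖z‖ ^ m`; together they form the Mahler measure to the power `m`.
  have hrC : (r : ℂ) = (F.map ι).leadingCoeff ^ m * ((F.map ι).roots.map (B.map ι).eval).prod := by
    rw [← resultant_eq_prod_eval _ _ m (natDegree_map_le.trans hm) (IsAlgClosed.splits _),
      natDegree_map_eq_of_injective hι, resultant_map_map]
    rfl
  have hcard : (F.map ι).roots.card = F.natDegree := by
    rw [← (IsAlgClosed.splits (F.map ι)).natDegree_eq_card_roots, natDegree_map_eq_of_injective hι]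
  have hbound : ‖(r : ℂ)‖ ≤ (F.map ι).mahlerMeasure ^ m * N ^ F.natDegree := by
    rw [hrC, mahlerMeasure_eq_leadingCoeff_mul_prod_roots, norm_mul, norm_pow, mul_pow, mul_assoc]
    refine mul_le_mul_of_nonneg_left ?_ (by positivity)
    rw [← hcard]
    generalize (F.map ι).roots = S
    induction S using Multiset.induction_on with
    | empty => simp
    | cons a S ih =>
      have h1 := hN a
      rw [aeval_def, eval₂_eq_eval_map] at h1
      simp only [Multiset.map_cons, Multiset.prod_cons, norm_mul, Multiset.card_cons]
      calc _ ≤ (N * max 1 ‖a‖ ^ m) * ((S.map fun a ↦ max 1 ‖a‖).prod ^ m * N ^ S.card) :=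
            mul_le_mul h1 ih (norm_nonneg _) ((norm_nonneg _).trans h1)
        _ = _ := by ring
  have hr0 : r = 0 := by
    refine Int.eq_zero_of_abs_lt_dvd hrp ?_
    have h2 := hbound.trans_lt hp
    rw [Complex.norm_intCast] at h2
    exact_mod_cast h2
  rw [hr0, Int.cast_zero, eq_comm, mul_eq_zero] at hrC
  have hF0 : (F.map ι) ≠ 0 := (Polynomial.map_ne_zero_iff hι).2 hF.ne_zero
  have h3 := hrC.resolve_left (pow_ne_zero _ (leadingCoeff_ne_zero.2 hF0))
  rw [Multiset.prod_eq_zero_iff, Multiset.mem_map] at h3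
  obtain ⟨z, hz, hz'⟩ := h3
  rw [mem_roots hF0, IsRoot, eval_map] at hz
  rw [eval_map] at hz'
  exact hF.dvd_of_common_root hd hz hz'

/-! ### Small polynomials and Mahler measure -/

/-- An integer polynomial is *`(s, N)`-small* if it is nonzero, of degree at most `s`, with
coefficients of total size at most `N`. -/
structure SmallPoly (s N : ℕ) (P : ℤ[X]) : Prop where
  ne_zero : P ≠ 0
  natDegree_le : P.natDegree ≤ s
  sum_abs_le : ∑ i ∈ Finset.range (s + 1), |P.coeff i| ≤ N

theorem SmallPoly.sum_norm_le {s N : ℕ} {P : ℤ[X]} (hP : SmallPoly s N P) :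
    ∑ i ∈ Finset.range (s + 1), ‖(P.coeff i : ℂ)‖ ≤ N := by
  simp only [Complex.norm_intCast]
  exact_mod_cast hP.sum_abs_le

theorem SmallPoly.norm_aeval_le {s N : ℕ} {P : ℤ[X]} (hP : SmallPoly s N P) (z : ℂ) :
    ‖aeval z P‖ ≤ N * max 1 ‖z‖ ^ s := by
  rw [aeval_eq_sum_range' (Nat.lt_succ_of_le hP.natDegree_le)]
  calc _ ≤ ∑ i ∈ Finset.range (s + 1), ‖(P.coeff i : ℂ)‖ * max 1 ‖z‖ ^ s := by
        refine (norm_sum_le _ _).trans (Finset.sum_le_sum fun i hi ↦ ?_)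
        rw [zsmul_eq_mul, norm_mul, norm_pow]
        refine mul_le_mul_of_nonneg_left ?_ (norm_nonneg _)
        calc ‖z‖ ^ i ≤ max 1 ‖z‖ ^ i := by gcongr; exact le_max_right _ _
          _ ≤ _ := pow_le_pow_right₀ (le_max_left _ _) (by simpa [Nat.lt_succ_iff] using hi)
    _ ≤ _ := by
        rw [← Finset.sum_mul]
        exact mul_le_mul_of_nonneg_right hP.sum_norm_le (by positivity)

/-- The cofactor is a nonzero integer polynomial, so its Mahler measure is at least 1. Factors thus
inherit the bound `N`, which their coefficients need not satisfy. -/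
theorem SmallPoly.mahlerMeasure_le {s N : ℕ} {P F : ℤ[X]} (hP : SmallPoly s N P) (hF : F ∣ P) :
    (F.map (Int.castRingHom ℂ)).mahlerMeasure ≤ N := by
  obtain ⟨G, rfl⟩ := hF
  have hG : 1 ≤ (G.map (Int.castRingHom ℂ)).mahlerMeasure :=
    one_le_mahlerMeasure_of_ne_zero (right_ne_zero_of_mul hP.ne_zero)
  calc _ ≤ (F.map (Int.castRingHom ℂ)).mahlerMeasure * (G.map (Int.castRingHom ℂ)).mahlerMeasure :=
        le_mul_of_one_le_right (mahlerMeasure_nonneg _) hG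
    _ = ((F * G).map (Int.castRingHom ℂ)).mahlerMeasure := by
        rw [Polynomial.map_mul, mahlerMeasure_mul]
    _ ≤ _ := mahlerMeasure_le_sum_norm_coeff _
    _ ≤ ∑ i ∈ Finset.range (s + 1), ‖((F * G).coeff i : ℂ)‖ := by
        rw [sum_def]
        simp only [coeff_map, eq_intCast]
        refine Finset.sum_le_sum_of_subset_of_nonneg (fun i hi ↦ ?_) fun _ _ _ ↦ norm_nonneg _
        rw [Finset.mem_range, Nat.lt_succ_iff]
        exact ((le_natDegree_of_mem_supp i hi).trans natDegree_map_le).trans hP.natDegree_le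
    _ ≤ N := hP.sum_norm_le

/-- A small polynomial vanishing at `x` modulo `p` has a nonconstant irreducible factor
vanishing at `x`. -/
theorem SmallPoly.exists_irreducible_factor {p s N : ℕ} [Fact p.Prime] {P : ℤ[X]}
    (hP : SmallPoly s N P) (hN : N < p) {x : ZMod p} (hx : aeval x P = 0) :
    ∃ F : ℤ[X], Irreducible F ∧ F.natDegree ≠ 0 ∧ F ∣ P ∧ aeval x F = 0 := by
  obtain ⟨S, hS, u, hu⟩ := WfDvdMonoid.exists_factors P hP.ne_zero
  have hSx : (S.map (aeval x)).prod = 0 := by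
    have h := hx
    rw [← hu, map_mul, mul_eq_zero] at h
    rw [← map_multiset_prod]
    exact h.resolve_right (u.isUnit.map (aeval x)).ne_zero
  rw [Multiset.prod_eq_zero_iff, Multiset.mem_map] at hSx
  obtain ⟨F, hFS, hFx⟩ := hSx
  have hFP : F ∣ P := (Multiset.dvd_prod hFS).trans ⟨u, hu.symm⟩
  refine ⟨F, hS F hFS, fun h0 ↦ ?_, hFP, hFx⟩
  have hM := hP.mahlerMeasure_le hFP
  rw [eq_C_of_natDegree_eq_zero h0, aeval_C] at hFx
  rw [eq_C_of_natDegree_eq_zero h0, map_C, mahlerMeasure_const] at hM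
  have h1 : (p : ℤ) ∣ F.coeff 0 := (ZMod.intCast_zmod_eq_zero_iff_dvd _ p).1 (by simpa using hFx)
  have h2 : F.coeff 0 = 0 := by
    refine Int.eq_zero_of_abs_lt_dvd h1 ?_
    have : |F.coeff 0| ≤ N := by
      have := hM
      simp only [eq_intCast, Complex.norm_intCast] at this
      exact_mod_cast this
    omega
  exact (hS F hFS).ne_zero (by rw [eq_C_of_natDegree_eq_zero h0, h2, C_0])

/-! ### An element without small relations -/

/-- If `F` is an irreducible integer polynomial with a root `α` that is zero or a root of unity,
and `F` vanishes modulo `p` at an element of order `t`, then `φ(t) ≤ deg F`. -/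
theorem totient_orderOf_le_natDegree {p : ℕ} [Fact p.Prime] {g : (ZMod p)ˣ} {F : ℤ[X]}
    (hF : Irreducible F) (hd : F.natDegree ≠ 0) (hg : aeval (g : ZMod p) F = 0) {α : ℂ}
    (hα : aeval α F = 0) {i j : ℕ} (hij : i < j) (hpow : α ^ i = α ^ j) :
    (orderOf g).totient ≤ F.natDegree := by
  rcases eq_or_ne α 0 with rfl | h0
  · obtain ⟨Q, hQ⟩ := hF.dvd_of_common_root hd hα (B := X) (by simp)
    have := congrArg (aeval (g : ZMod p)) hQ
    simp [hg] at this
  have hm : α ^ (j - i) = 1 := by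
    have : α ^ i * α ^ (j - i) = α ^ i * 1 := by rw [← pow_add, mul_one, hpow]; congr 1; omega
    exact mul_left_cancel₀ (pow_ne_zero _ h0) this
  have hfin : 0 < orderOf α := orderOf_pos_iff.2 (isOfFinOrder_iff_pow_eq_one.2 ⟨_, by omega, hm⟩)
  have hprim := IsPrimitiveRoot.orderOf α
  have hroot : aeval α (cyclotomic (orderOf α) ℤ) = 0 := by
    have := hprim.isRoot_cyclotomic hfin
    rwa [aeval_def, eval₂_eq_eval_map, map_cyclotomic]
  have hdvd := hF.dvd_of_common_root hd hα hroot
  have hassoc : Associated F (cyclotomic (orderOf α) ℤ) :=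
    hF.associated_of_dvd (cyclotomic.irreducible hfin) hdvd
  have hdeg : F.natDegree = (orderOf α).totient := by
    rw [natDegree_eq_of_degree_eq (degree_eq_degree_of_associated hassoc), natDegree_cyclotomic]
  have hgm : g ^ orderOf α = 1 := by
    obtain ⟨Q, hQ⟩ := hdvd.trans (cyclotomic.dvd_X_pow_sub_one (orderOf α) ℤ)
    have := congrArg (aeval (g : ZMod p)) hQ
    rw [map_mul, hg, zero_mul] at this
    ext
    simpa [sub_eq_zero] using this
  rw [hdeg]
  exact Nat.le_of_dvd (Nat.totient_pos.2 hfin) (Nat.totient_dvd_of_dvd (orderOf_dvd_of_pow_eq_one hgm))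

/-- In a multiplicative subgroup of `F_p^*` generated by `g`, some power of `g` satisfies no small
polynomial relation of degree less than `φ(ord g)`. -/
theorem exists_pow_forall_smallPoly_aeval_ne_zero {p s N : ℕ} [Fact p.Prime] (g : (ZMod p)ˣ)
    (hs0 : s ≠ 0) (hs : s < (orderOf g).totient) (hp : N ^ (3 * s) < p) :
    ∃ h ∈ Subgroup.zpowers g, ∀ P : ℤ[X], SmallPoly s N P → aeval (h : ZMod p) P ≠ 0 := by
  by_contra! hcon
  choose! P hP hPx using hcon
  have hNp : N < p := (Nat.le_self_pow (by omega) N).trans_lt hp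
  have hmem : ∀ k : ℕ, g ^ k ∈ Subgroup.zpowers g := fun k ↦
    Subgroup.pow_mem _ (Subgroup.mem_zpowers g) k
  obtain ⟨F, hF, hFd, hFP, hFg⟩ := (hP g (Subgroup.mem_zpowers g)).exists_irreducible_factor hNp
    (hPx g (Subgroup.mem_zpowers g))
  obtain ⟨α, hα⟩ : ∃ α : ℂ, aeval α F = 0 :=
    IsAlgClosed.exists_aeval_eq_zero_of_injective ℂ Int.cast_injective F
      (fun h ↦ hFd (natDegree_eq_of_degree_eq_some h))
  have chain : ∀ k : ℕ, ∃ G : ℤ[X], Irreducible G ∧ G.natDegree ≠ 0 ∧ G ∣ P (g ^ 2 ^ k) ∧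
      aeval ((g ^ 2 ^ k : (ZMod p)ˣ) : ZMod p) G = 0 ∧ aeval (α ^ 2 ^ k) G = 0 := by
    intro k
    induction k with
    | zero => exact ⟨F, hF, hFd, by simpa using hFP, by simpa using hFg, by simpa using hα⟩
    | succ k ih =>
      obtain ⟨G, hG, hGd, hGP, hGg, hGα⟩ := ih
      set x := g ^ 2 ^ k
      set β := α ^ 2 ^ k
      have hx2 : g ^ 2 ^ (k + 1) = x ^ 2 := by rw [pow_succ 2 k, pow_mul]
      have hβ2 : α ^ 2 ^ (k + 1) = β ^ 2 := by rw [pow_succ 2 k, pow_mul]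
      rw [hx2, hβ2]
      have hx2mem : x ^ 2 ∈ Subgroup.zpowers g := hx2 ▸ hmem _
      have hQ := hP _ hx2mem
      have hQx := hPx _ hx2mem
      set Q := P (x ^ 2)
      have hGs : G.natDegree ≤ s :=
        (natDegree_le_of_dvd hGP (hP x (hmem _)).ne_zero).trans (hP x (hmem _)).natDegree_le
      have hN1 : 1 ≤ N := by
        by_contra hN0
        have h1 := hQ.mahlerMeasure_le (one_dvd Q)
        simp only [Polynomial.map_one, mahlerMeasure_one] at h1
        exact hN0 (by exact_mod_cast h1)
      -- `Q(X²)` has degree at most `2s` and size `N`, while `G` has Mahler measure at most `N` and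
      -- degree at most `s`: hence the exponent `2s + s = 3s`.
      have hGQ : G ∣ expand ℤ 2 Q := by
        refine hG.dvd_of_common_root_zmod hGd hGg (m := 2 * s) (N := N) ?_ ?_ ?_ ?_
        · rw [expand_aeval, ← Units.val_pow_eq_pow_val]; exact hQx
        · rw [natDegree_expand]; have := hQ.natDegree_le; omega
        · intro z
          rw [expand_aeval]
          refine (hQ.norm_aeval_le _).trans (le_of_eq ?_)
          rw [pow_mul, norm_pow]
          congr 2
          rcases le_total 1 ‖z‖ with h | h
          · rw [max_eq_right h, max_eq_right (one_le_pow₀ h)]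
          · rw [max_eq_left h, max_eq_left (pow_le_one₀ (norm_nonneg _) h), one_pow]
        · calc _ ≤ (N : ℝ) ^ (2 * s) * (N : ℝ) ^ s := by
                gcongr
                · exact mahlerMeasure_nonneg _
                · exact (hP x (hmem _)).mahlerMeasure_le hGP
                · exact_mod_cast hN1
            _ = ((N ^ (3 * s) : ℕ) : ℝ) := by push_cast; rw [← pow_add]; congr 1; ring
            _ < p := by exact_mod_cast hp
      have hQβ : aeval (β ^ 2) Q = 0 := by
        obtain ⟨R, hR⟩ := hGQ
        have := congrArg (aeval β) hR
        rwa [expand_aeval, map_mul, hGα, zero_mul] at this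
      obtain ⟨S, hS, u, hu⟩ := WfDvdMonoid.exists_factors Q hQ.ne_zero
      have hSβ : (S.map (aeval (β ^ 2))).prod = 0 := by
        rw [← hu, map_mul, mul_eq_zero] at hQβ
        rw [← map_multiset_prod]
        exact hQβ.resolve_right (u.isUnit.map (aeval (β ^ 2))).ne_zero
      rw [Multiset.prod_eq_zero_iff, Multiset.mem_map] at hSβ
      obtain ⟨G', hGS, hG'β⟩ := hSβ
      have hG' := hS G' hGS
      refine ⟨G', hG', fun h0 ↦ ?_, (Multiset.dvd_prod hGS).trans ⟨u, hu.symm⟩, ?_, hG'β⟩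
      · rw [eq_C_of_natDegree_eq_zero h0, aeval_C] at hG'β
        have : G'.coeff 0 = 0 := by simpa using hG'β
        exact hG'.ne_zero (by rw [eq_C_of_natDegree_eq_zero h0, this, C_0])
      -- The factor was chosen by its complex root `β ^ 2`; divisibility over `ℤ` carries the
      -- vanishing back to `x ^ 2` modulo `p`.
      · obtain ⟨R, hR⟩ := hG.dvd_of_common_root hGd hGα (B := expand ℤ 2 G') (by rwa [expand_aeval])
        have := congrArg (aeval (x : ZMod p)) hR
        rwa [expand_aeval, map_mul, hGg, zero_mul, ← Units.val_pow_eq_pow_val] at this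
  have hfin : (⋃ x ∈ (Subgroup.zpowers g : Set (ZMod p)ˣ), (P x).rootSet ℂ).Finite :=
    (Set.toFinite _).biUnion fun x _ ↦ rootSet_finite _ _
  have hmaps : ∀ k : ℕ, α ^ 2 ^ k ∈ ⋃ x ∈ (Subgroup.zpowers g : Set (ZMod p)ˣ), (P x).rootSet ℂ := by
    intro k
    obtain ⟨G, -, -, hGP, -, hGα⟩ := chain k
    refine Set.mem_biUnion (hmem (2 ^ k)) ((mem_rootSet_of_ne (hP _ (hmem _)).ne_zero).2 ?_)
    obtain ⟨R, hR⟩ := hGP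
    rw [hR, map_mul, hGα, zero_mul]
  obtain ⟨a, -, b, -, hab, hpow⟩ := Set.infinite_univ.exists_ne_map_eq_of_mapsTo
    (f := fun k : ℕ ↦ α ^ 2 ^ k) (fun k _ ↦ hmaps k) hfin
  have hle : F.natDegree ≤ s := (natDegree_le_of_dvd hFP (hP g (Subgroup.mem_zpowers g)).ne_zero).trans
    (hP g (Subgroup.mem_zpowers g)).natDegree_le
  have key : (orderOf g).totient ≤ F.natDegree := by
    rcases lt_or_gt_of_ne hab with h | h
    · exact totient_orderOf_le_natDegree hF hFd hFg hα (Nat.pow_lt_pow_right one_lt_two h) hpow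
    · exact totient_orderOf_le_natDegree hF hFd hFg hα (Nat.pow_lt_pow_right one_lt_two h) hpow.symm
  omega

/-! ### Distinct elements of the iterated sumset -/

theorem zero_mem_iteratedSumset_zero {G : Type*} [AddCommMonoid G] (A : Set G) :
    (0 : G) ∈ iteratedSumset 0 A :=
  ⟨Fin.elim0, fun i ↦ i.elim0, by simp⟩

theorem mem_iteratedSumset_one {G : Type*} [AddCommMonoid G] {A : Set G} {a : G} (ha : a ∈ A) :
    a ∈ iteratedSumset 1 A :=
  ⟨fun _ ↦ a, fun _ ↦ ha, by simp⟩

theorem add_mem_iteratedSumset {G : Type*} [AddCommMonoid G] {A : Set G} {m n : ℕ} {x y : G}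
    (hx : x ∈ iteratedSumset m A) (hy : y ∈ iteratedSumset n A) :
    x + y ∈ iteratedSumset (m + n) A := by
  obtain ⟨u, hu, rfl⟩ := hx
  obtain ⟨v, hv, rfl⟩ := hy
  refine ⟨Fin.append u v, fun i ↦ ?_, by simp [Fin.sum_univ_add]⟩
  induction i using Fin.addCases <;> simp [hu, hv]

theorem nsmul_mem_iteratedSumset {G : Type*} [AddCommMonoid G] {A : Set G} {a : G} (ha : a ∈ A)
    (n : ℕ) : n • a ∈ iteratedSumset n A :=
  ⟨fun _ ↦ a, fun _ ↦ ha, by simp⟩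

theorem sum_nsmul_mem_iteratedSumset {G ι : Type*} [AddCommMonoid G] {A : Set G} (S : Finset ι)
    (c : ι → ℕ) {a : ι → G} (ha : ∀ i, a i ∈ A) :
    ∑ i ∈ S, c i • a i ∈ iteratedSumset (∑ i ∈ S, c i) A := by
  classical
  induction S using Finset.induction_on with
  | empty => simpa using zero_mem_iteratedSumset_zero A
  | insert i S hi ih =>
    rw [Finset.sum_insert hi, Finset.sum_insert hi]
    exact add_mem_iteratedSumset (nsmul_mem_iteratedSumset (ha i) _) ih

/-- If `h` satisfies no small polynomial relation, then sums of multiples of `h, h², …, h^s` padded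
by ones are distinct. -/
theorem injective_sum_nsmul_pow {p s H : ℕ} {h : ZMod p}
    (hh : ∀ P : ℤ[X], SmallPoly s (2 * (s * H)) P → aeval h P ≠ 0) :
    Function.Injective fun c : Fin s → Fin H ↦
      ∑ i, (c i : ℕ) • h ^ (i + 1 : ℕ) + (s * H - ∑ i, (c i : ℕ)) • (1 : ZMod p) := by
  intro c c' hcc
  by_contra hne
  have hle : ∀ c : Fin s → Fin H, ∑ i, (c i : ℕ) ≤ s * H := fun c ↦ by
    simpa using Finset.sum_le_card_nsmul Finset.univ (fun i ↦ (c i : ℕ)) H fun i _ ↦ (c i).2.le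
  set d : Fin s → ℤ := fun i ↦ (c i : ℤ) - (c' i : ℤ) with hd
  -- The constant term records the difference of the paddings. It at most doubles the coefficient
  -- sum, whence `2 * (s * H)`.
  set P : ℤ[X] := ∑ i : Fin s, C (d i) * X ^ (i + 1 : ℕ) + C (-∑ i, d i) with hP
  have hcoeff : ∀ i : Fin s, P.coeff (i + 1) = d i := by
    intro i
    simp only [hP, coeff_add, finsetSum_coeff, coeff_C_mul, coeff_X_pow, coeff_C_succ, add_zero,
      add_left_inj, Fin.val_inj]
    simp
  have hcoeff0 : P.coeff 0 = -∑ i, d i := by simp [hP]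
  have hdabs : ∑ i, |d i| ≤ s * H := by
    have : ∀ i ∈ Finset.univ, |d i| ≤ (H : ℤ) := fun i _ ↦ by
      have h1 := (c i).2
      have h2 := (c' i).2
      rw [abs_le]
      simp only [hd]
      omega
    simpa using Finset.sum_le_card_nsmul Finset.univ (fun i ↦ |d i|) H this
  refine hh P ⟨fun h0 ↦ hne ?_, ?_, ?_⟩ ?_
  · ext i
    have := hcoeff i
    rw [h0, coeff_zero] at this
    simp only [hd] at this
    omega
  · refine natDegree_add_le_of_degree_le (natDegree_sum_le_of_forall_le _ _ fun i _ ↦ ?_)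
      ((natDegree_C _).trans_le s.zero_le)
    exact (natDegree_C_mul_X_pow_le _ _).trans i.2
  · rw [Finset.sum_range_succ', Finset.sum_range fun i ↦ |P.coeff (i + 1)|]
    simp only [hcoeff, hcoeff0, abs_neg]
    have := Finset.abs_sum_le_sum_abs d Finset.univ
    push_cast
    linarith
  · have h1 : aeval h P = ∑ i, (d i : ZMod p) * h ^ (i + 1 : ℕ) + -∑ i, (d i : ZMod p) := by
      simp [hP]
    have h2 : ∀ i, (d i : ZMod p) = (c i : ℕ) - (c' i : ℕ) := fun i ↦ by simp [hd]
    simp only [nsmul_eq_mul, mul_one, Nat.cast_sub (hle _), Nat.cast_sum] at hcc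
    rw [h1]
    simp only [h2, sub_mul, Finset.sum_sub_distrib]
    linear_combination hcc

/-- A lower bound for the size of the iterated sumset of a multiplicative subgroup of `F_p^*`. -/
theorem pow_le_ncard_iteratedSumset {p s H : ℕ} [Fact p.Prime] (Γ : Subgroup (ZMod p)ˣ)
    (hs : s < (Nat.card Γ).totient) (hp : (2 * (s * H)) ^ (3 * s) < p) :
    H ^ s ≤ (iteratedSumset (s * H) (subgroupSet Γ)).ncard := by
  rcases eq_or_ne s 0 with rfl | hs0
  · rw [pow_zero, Nat.one_le_iff_ne_zero, zero_mul]
    exact (Set.ncard_pos (Set.toFinite _)).2 ⟨0, zero_mem_iteratedSumset_zero _⟩ |>.ne'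
  obtain ⟨g, rfl⟩ : ∃ g, Subgroup.zpowers g = Γ :=
    (Subgroup.isCyclic_iff_exists_zpowers_eq_top Γ).1 inferInstance
  rw [Nat.card_zpowers] at hs
  obtain ⟨h, hmem, hh⟩ := exists_pow_forall_smallPoly_aeval_ne_zero g hs0 hs hp
  have hinj := injective_sum_nsmul_pow hh
  calc H ^ s = (Set.range _).ncard := by
        rw [← Set.image_univ, Set.ncard_image_of_injective _ hinj, Set.ncard_univ]; simp
    _ ≤ _ := by
      refine Set.ncard_le_ncard ?_ (Set.toFinite _)
      rintro _ ⟨c, rfl⟩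
      have hle : ∑ i, (c i : ℕ) ≤ s * H := by
        simpa using Finset.sum_le_card_nsmul Finset.univ (fun i ↦ (c i : ℕ)) H fun i _ ↦ (c i).2.le
      have := add_mem_iteratedSumset
        (sum_nsmul_mem_iteratedSumset (A := subgroupSet (Subgroup.zpowers g)) Finset.univ
          (fun i ↦ (c i : ℕ)) (a := fun i : Fin s ↦ (h : ZMod p) ^ (i + 1 : ℕ))
          fun i ↦ ⟨h ^ (i + 1 : ℕ), Subgroup.pow_mem _ hmem _, by simp⟩)
        (nsmul_mem_iteratedSumset (A := subgroupSet (Subgroup.zpowers g)) (a := 1)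
          ⟨1, one_mem _, by simp⟩ (s * H - ∑ i, (c i : ℕ)))
      rwa [Nat.add_sub_cancel' hle] at this

theorem card_le_ncard_iteratedSumset_one {p : ℕ} [Fact p.Prime] (Γ : Subgroup (ZMod p)ˣ) :
    Nat.card Γ ≤ (iteratedSumset 1 (subgroupSet Γ)).ncard := by
  calc Nat.card Γ = (((↑) : (ZMod p)ˣ → ZMod p) '' (Γ : Set (ZMod p)ˣ)).ncard := by
        rw [Set.ncard_image_of_injective _ Units.val_injective]; rfl
    _ ≤ _ := by
        refine Set.ncard_le_ncard ?_ (Set.toFinite _)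
        rintro _ ⟨u, hu, rfl⟩
        exact mem_iteratedSumset_one ⟨u, hu, rfl⟩

/-! ### Lower bounds for the totient -/

theorem Nat.Prime.pow_le_totient_sq {q k : ℕ} (hq : q.Prime) (hk : 0 < k) (h2 : q ≠ 2) :
    q ^ k ≤ (q ^ k).totient ^ 2 := by
  obtain ⟨j, rfl⟩ := Nat.exists_eq_succ_of_ne_zero hk.ne'
  rw [Nat.succ_eq_add_one, Nat.totient_prime_pow_succ hq, pow_succ, mul_pow]
  have h3 : 3 ≤ q := by have := hq.two_le; omega
  refine Nat.mul_le_mul (Nat.le_self_pow two_ne_zero _) ?_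
  obtain ⟨r, rfl⟩ : ∃ r, q = r + 3 := ⟨q - 3, by omega⟩
  rw [show r + 3 - 1 = r + 2 by omega]
  nlinarith

theorem Nat.le_totient_sq_of_odd {n : ℕ} : Odd n → n ≤ n.totient ^ 2 := by
  induction n using Nat.recOnPosPrimePosCoprime with
  | prime_pow q k hq hk =>
    intro hodd
    refine hq.pow_le_totient_sq hk ?_
    rintro rfl
    rw [Nat.odd_pow_iff hk.ne'] at hodd
    exact absurd hodd (by decide)
  | zero => simp
  | one => simp
  | coprime a b _ _ hab iha ihb =>
    intro hodd
    rw [Nat.odd_mul] at hodd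
    rw [Nat.totient_mul hab, mul_pow]
    exact Nat.mul_le_mul (iha hodd.1) (ihb hodd.2)

/-- The factor 2 pays for the power of two in `n`; the odd part needs no loss because `q ≤ (q - 1)²`
for `q ≥ 3`. -/
theorem Nat.le_two_mul_totient_sq (n : ℕ) : n ≤ 2 * n.totient ^ 2 := by
  rcases eq_or_ne n 0 with rfl | hn
  · simp
  obtain ⟨k, m, hm, rfl⟩ := Nat.exists_eq_two_pow_mul_odd hn
  rw [Nat.totient_mul (Nat.Coprime.pow_left _ hm.coprime_two_left), mul_pow, ← mul_assoc]
  refine Nat.mul_le_mul ?_ (Nat.le_totient_sq_of_odd hm)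
  rcases k with _ | k
  · simp
  · rw [Nat.totient_prime_pow_succ Nat.prime_two, pow_succ]
    have := Nat.le_self_pow two_ne_zero (2 ^ k)
    simp only [Nat.add_one_sub_one, mul_one]
    omega

/-! ### Choice of the parameters -/

theorem Real.twelve_mul_logb_two_le {x : ℝ} (hx : 128 ≤ x) : 12 * Real.logb 2 x ≤ x := by
  have hl := Real.log_two_gt_d9
  have h1 : Real.log x = 7 * Real.log 2 + Real.log (x / 128) := by
    rw [Real.log_div (by positivity) (by norm_num), show (128 : ℝ) = 2 ^ 7 by norm_num,
      Real.log_pow]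
    push_cast
    ring
  have h2 : Real.log (x / 128) ≤ x / 128 - 1 := Real.log_le_sub_one_of_pos (by positivity)
  rw [Real.logb, mul_div_assoc', div_le_iff₀ (by linarith)]
  nlinarith

theorem Real.logb_two_le_two_mul {x : ℝ} (hx : 0 < x) : Real.logb 2 x ≤ 2 * x := by
  have hl := Real.log_two_gt_d9
  have h2 := Real.log_le_sub_one_of_pos hx
  rw [Real.logb, div_le_iff₀ (by linarith)]
  nlinarith

/-- Take the smaller of `f - 1` and the integer part of `L / (12 log L)`. Each loses at most a
factor 2 to rounding, whence `24 = 2 * 12`. -/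
theorem exists_degree_parameter {f : ℕ} (hf : 2 ≤ f) {L : ℝ} (hL : 128 ≤ L) :
    ∃ s : ℕ, s < f ∧ s * (12 * Real.logb 2 L) ≤ L ∧
      min (f : ℝ) (L / Real.logb 2 L) ≤ 24 * s := by
  have hl : 0 < Real.logb 2 L := Real.logb_pos one_lt_two (by linarith)
  set y := L / (12 * Real.logb 2 L)
  have hy : 1 ≤ y := (one_le_div (by positivity)).2 (Real.twelve_mul_logb_two_le hL)
  have hy1 : (1 : ℝ) ≤ ⌊y⌋₊ := by exact_mod_cast (Nat.one_le_floor_iff y).2 hy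
  have hy2 := Nat.lt_floor_add_one y
  have hyL : L / Real.logb 2 L = 12 * y := by simp only [y]; field_simp
  refine ⟨min (f - 1) ⌊y⌋₊, (min_le_left _ _).trans_lt (by omega), ?_, ?_⟩
  · rw [← le_div_iff₀ (by positivity)]
    exact (Nat.cast_le.2 (min_le_right _ _)).trans (Nat.floor_le (by linarith))
  · rcases min_cases (f - 1) ⌊y⌋₊ with ⟨h, -⟩ | ⟨h, -⟩ <;> rw [h]
    · have : (2 : ℝ) ≤ f := by exact_mod_cast hf
      rw [Nat.cast_sub (by omega), Nat.cast_one]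
      exact (min_le_left _ _).trans (by linarith)
    · exact (min_le_right _ _).trans (by linarith)

/-- The base is at most `L²`, so the logarithm of the power is at most `6 s log L ≤ L / 2`. -/
theorem two_mul_pow_lt_of_le {p s H : ℕ} (hL : 128 ≤ Real.logb 2 p)
    (hs : s * (12 * Real.logb 2 (Real.logb 2 p)) ≤ Real.logb 2 p) (hH : (H : ℝ) ≤ Real.logb 2 p) :
    (2 * (s * H)) ^ (3 * s) < p := by
  set L := Real.logb 2 p
  have hp : (0 : ℝ) < p := by
    rcases Nat.eq_zero_or_pos p with rfl | h
    · simp [L] at hL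
      linarith
    · exact_mod_cast h
  have hl : 1 ≤ Real.logb 2 L := by
    rw [Real.le_logb_iff_rpow_le one_lt_two (by linarith), Real.rpow_one]
    linarith
  have hs' : (s : ℝ) * 12 ≤ L := by nlinarith [(Nat.cast_nonneg s : (0 : ℝ) ≤ s)]
  have h1 : (2 * (s * H) : ℝ) ≤ L ^ 2 := by
    nlinarith [mul_le_mul hs' hH (Nat.cast_nonneg H) (by linarith : (0 : ℝ) ≤ L),
      mul_nonneg (Nat.cast_nonneg s : (0 : ℝ) ≤ s) (Nat.cast_nonneg H : (0 : ℝ) ≤ H)]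
  have h2 : ((2 * (s * H)) ^ (3 * s) : ℝ) < p := by
    refine (pow_le_pow_left₀ (by positivity) h1 _).trans_lt ?_
    rw [← Real.logb_lt_logb_iff one_lt_two (by positivity) hp, Real.logb_pow, Real.logb_pow]
    push_cast
    change _ < L
    linarith
  exact_mod_cast h2

/-! ### The two estimates -/

theorem exists_iteratedSumset_of_card_le_rpow {p : ℕ} [Fact p.Prime] (Γ : Subgroup (ZMod p)ˣ)
    {C : ℝ} (hC : 1 ≤ C)
    (h1 : Real.logb 2 p ≤ (Nat.card Γ).totient * Real.logb 2 (Nat.card Γ))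
    (h2 : (Nat.card Γ : ℝ) ≤ Real.logb 2 p ^ C) :
    ∃ n : ℕ, (n : ℝ) ≤ 2 * (Real.logb 2 p ^ 2 / Real.logb 2 (Real.logb 2 p)) ∧
      (p : ℝ) ^ ((1 / 256 : ℝ) / C) ≤ ((iteratedSumset n (subgroupSet Γ)).ncard : ℝ) := by
  have hp2 : (2 : ℝ) ≤ p := by exact_mod_cast (Fact.out : p.Prime).two_le
  have hp0 : (0 : ℝ) < p := by linarith
  set t := Nat.card Γ
  set L := Real.logb 2 p with hLdef
  have hL0 : 0 < L := Real.logb_pos one_lt_two (by linarith)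
  have ht : 2 ≤ t := by
    by_contra hlt
    have : t = 0 ∨ t = 1 := by omega
    rcases this with h | h <;> simp [h] at h1 <;> linarith
  have ht' : (2 : ℝ) ≤ t := by exact_mod_cast ht
  have hL1 : 1 < L := by
    by_contra! hle
    have := Real.rpow_le_one hL0.le hle (by linarith : 0 ≤ C)
    linarith
  have hl : 0 < Real.logb 2 L := Real.logb_pos one_lt_two hL1
  have hpow : (p : ℝ) ^ ((1 / 256 : ℝ) / C) = 2 ^ (L * (1 / 256 / C)) := by
    rw [Real.rpow_mul zero_le_two, Real.rpow_logb two_pos (by norm_num) hp0]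
  have hC0 : 0 < C := by linarith
  rcases lt_or_ge L 128 with hsmall | hL
  · refine ⟨1, ?_, ?_⟩
    · rw [mul_div_assoc', le_div_iff₀ hl]
      have := Real.logb_two_le_two_mul hL0
      push_cast
      nlinarith
    · calc (p : ℝ) ^ ((1 / 256 : ℝ) / C) ≤ 2 ^ (1 : ℝ) := by
            rw [hpow]
            refine Real.rpow_le_rpow_of_exponent_le one_le_two ?_
            rw [mul_div_assoc', div_le_one hC0]
            linarith
        _ ≤ t := by rwa [Real.rpow_one]
        _ ≤ _ := by exact_mod_cast card_le_ncard_iteratedSumset_one Γ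
  · have hf : 2 ≤ t.totient := by
      by_contra hlt
      have h3 := Nat.le_of_dvd two_pos (Nat.dvd_two_of_totient_le_one (by omega)
        (by omega : t.totient ≤ 1))
      have h4 : t = 2 := by omega
      rw [h4] at h1
      simp at h1
      linarith
    obtain ⟨s, hsf, hsL, hmin⟩ := exists_degree_parameter hf hL
    have hHL : (⌊L⌋₊ : ℝ) ≤ L := Nat.floor_le hL0.le
    have hcore := pow_le_ncard_iteratedSumset Γ hsf (two_mul_pow_lt_of_le hL hsL hHL)
    -- With `H = ⌊L⌋`, the hypotheses give `φ(t) ≥ L / (C log L)`, so `s log H` is at least a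
    -- constant times `L / C`.
    refine ⟨s * ⌊L⌋₊, ?_, ?_⟩
    · rw [mul_div_assoc', le_div_iff₀ hl]
      push_cast
      have h5 : (s : ℝ) * Real.logb 2 L * ⌊L⌋₊ ≤ s * Real.logb 2 L * L := by gcongr
      nlinarith
    · refine le_trans ?_ (Nat.cast_le.2 hcore : ((⌊L⌋₊ ^ s : ℕ) : ℝ) ≤ _)
      have hHlow : Real.logb 2 L / 2 ≤ Real.logb 2 ⌊L⌋₊ := by
        have h6 := Nat.lt_floor_add_one L
        rw [div_le_iff₀ two_pos, mul_comm, ← Nat.cast_two (R := ℝ), ← Real.logb_pow]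
        push_cast
        refine Real.logb_le_logb_of_le one_lt_two hL0 ?_
        nlinarith
      have hHpos : (0 : ℝ) < ⌊L⌋₊ := by
        have h6 := Nat.lt_floor_add_one L
        linarith
      have hlt : Real.logb 2 t ≤ C * Real.logb 2 L := by
        rw [← Real.logb_rpow_eq_mul_logb_of_pos hL0]
        exact Real.logb_le_logb_of_le one_lt_two (by linarith) h2
      have hkey : L / C ≤ 24 * s * Real.logb 2 L := by
        refine le_trans ?_ (mul_le_mul_of_nonneg_right hmin hl.le)
        rw [min_mul_of_nonneg _ _ hl.le, div_mul_cancel₀ _ hl.ne']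
        refine le_min ?_ (div_le_self hL0.le hC)
        rw [div_le_iff₀ hC0]
        calc L ≤ t.totient * Real.logb 2 t := h1
          _ ≤ t.totient * (C * Real.logb 2 L) := by gcongr
          _ = _ := by ring
      push_cast
      rw [hpow, ← Real.logb_le_logb one_lt_two (by positivity) (by positivity),
        Real.logb_rpow two_pos (by norm_num), Real.logb_pow]
      calc L * (1 / 256 / C) = (L / C) / 256 := by ring
        _ ≤ (24 * s * Real.logb 2 L) / 256 := by gcongr
        _ ≤ s * (Real.logb 2 L / 2) := by
            have : 0 ≤ s * Real.logb 2 L := by positivity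
            nlinarith
        _ ≤ _ := by gcongr

theorem exists_iteratedSumset_of_card_le_logb {p : ℕ} [Fact p.Prime] (Γ : Subgroup (ZMod p)ˣ)
    (h : (Nat.card Γ : ℝ) ≤ Real.logb 2 p) :
    ∃ n : ℕ, (n : ℝ) ≤ 2 * (((Nat.card Γ).totient : ℝ) ^ 2 * Real.logb 2 (Nat.card Γ)) ∧
      Real.exp (Real.logb 2 (Nat.card Γ) * (1 / 256 * min ((Nat.card Γ).totient : ℝ)
        (Real.logb 2 p / Real.logb 2 (Real.logb 2 p)))) ≤
        ((iteratedSumset n (subgroupSet Γ)).ncard : ℝ) := by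
  have htpos : 0 < Nat.card Γ := Nat.card_pos
  have hcard1 := card_le_ncard_iteratedSumset_one Γ
  set t := Nat.card Γ
  set L := Real.logb 2 p with hLdef
  rcases (Nat.succ_le_of_lt htpos).eq_or_lt' with ht | ht
  · refine ⟨0, by simp [ht], ?_⟩
    rw [ht]
    simp only [Nat.cast_one, Real.logb_one, zero_mul, Real.exp_zero, Nat.one_le_cast]
    exact (Set.ncard_pos (Set.toFinite _)).2 ⟨0, zero_mem_iteratedSumset_zero _⟩
  have ht2 : (2 : ℝ) ≤ t := by exact_mod_cast ht
  have hL2 : 2 ≤ L := ht2.trans h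
  have hl : 1 ≤ Real.logb 2 L := by
    rwa [Real.le_logb_iff_rpow_le one_lt_two (by linarith), Real.rpow_one]
  have hlt : 1 ≤ Real.logb 2 t := by
    rwa [Real.le_logb_iff_rpow_le one_lt_two (by linarith), Real.rpow_one]
  have hln := Real.log_two_gt_d9
  have hlogt : Real.log t = Real.logb 2 t * Real.log 2 := by
    rw [Real.logb, div_mul_cancel₀ _ (by positivity)]
  by_cases hsmall : t.totient ≤ 1 ∨ L < 128
  · refine ⟨1, ?_, ?_⟩
    · have : (1 : ℝ) ≤ t.totient := by exact_mod_cast Nat.totient_pos.2 htpos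
      have := mul_le_mul (one_le_pow₀ this (n := 2)) hlt zero_le_one (by positivity)
      push_cast
      linarith
    -- Then the target is at most `exp (logb 2 t / 2)`, which is at most `t` since `log 2 > 1 / 2`.
    · have hmin : min (t.totient : ℝ) (L / Real.logb 2 L) ≤ 128 := by
        rcases hsmall with h1 | h1
        · have : (t.totient : ℝ) ≤ 1 := by exact_mod_cast h1
          exact (min_le_left _ _).trans (by linarith)
        · exact (min_le_right _ _).trans ((div_le_self (by linarith) hl).trans h1.le)
      calc _ ≤ Real.exp (Real.log t) := by
            rw [Real.exp_le_exp, hlogt]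
            gcongr
            linarith
        _ = t := Real.exp_log (by linarith)
        _ ≤ _ := by exact_mod_cast hcard1
  · push Not at hsmall
    obtain ⟨hf, hL⟩ := hsmall
    obtain ⟨s, hsf, hsL, hmin⟩ := exists_degree_parameter hf hL
    have hfL : (t.totient : ℝ) ≤ L := le_trans (by exact_mod_cast Nat.totient_le t) h
    have hcore := pow_le_ncard_iteratedSumset Γ hsf (two_mul_pow_lt_of_le hL hsL hfL)
    -- `H = φ(t)` keeps `sH` below `φ(t)²`, and `t ≤ 2 φ(t)² ≤ φ(t)³` makes `log H` comparable with
    -- `log t`.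
    refine ⟨s * t.totient, ?_, ?_⟩
    · have h3 : (s : ℝ) ≤ t.totient := by exact_mod_cast hsf.le
      have h4 : (s : ℝ) * t.totient ≤ t.totient ^ 2 := by rw [sq]; gcongr
      push_cast
      nlinarith [sq_nonneg (t.totient : ℝ)]
    · refine le_trans ?_ (Nat.cast_le.2 hcore : ((t.totient ^ s : ℕ) : ℝ) ≤ _)
      have hf0 : (0 : ℝ) < t.totient := by exact_mod_cast (by omega : 0 < t.totient)
      have h3 : Real.log t ≤ 3 * Real.log t.totient := by
        rw [← Nat.cast_three (R := ℝ), ← Real.log_pow]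
        refine Real.log_le_log (by linarith) ?_
        have : t ≤ t.totient ^ 3 := (Nat.le_two_mul_totient_sq t).trans (by
          rw [pow_succ' _ 2]
          exact Nat.mul_le_mul_right _ hf)
        exact_mod_cast this
      push_cast
      rw [← Real.exp_log (pow_pos hf0 s), Real.exp_le_exp, Real.log_pow]
      calc _ ≤ Real.logb 2 t * (1 / 256 * (24 * s)) := by gcongr
        _ ≤ s * (Real.log t / 3) := by
            rw [hlogt]
            have : 0 ≤ s * Real.logb 2 t := by positivity
            nlinarith
        _ ≤ s * Real.log t.totient := by gcongr; linarith

theorem corollaryc :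
    ∃ K : ℝ, 0 < K ∧ ∃ c : ℝ, 0 < c ∧
      ∀ (p : ℕ), p.Prime → ∀ (Γ : Subgroup (ZMod p)ˣ),
        (∀ C : ℝ, 1 ≤ C →
          Real.logb 2 (p : ℝ) ≤
            (Nat.totient (Nat.card Γ) : ℝ) * Real.logb 2 (Nat.card Γ : ℝ) →
          (Nat.card Γ : ℝ) ≤ Real.logb 2 (p : ℝ) ^ C →
          ∃ n : ℕ,
            (n : ℝ) ≤ K * (Real.logb 2 (p : ℝ) ^ 2 / Real.logb 2 (Real.logb 2 (p : ℝ))) ∧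
            (p : ℝ) ^ (c / C) ≤ ((iteratedSumset n (subgroupSet Γ)).ncard : ℝ)) ∧
        ((Nat.card Γ : ℝ) ≤ Real.logb 2 (p : ℝ) →
          ∃ n : ℕ,
            (n : ℝ) ≤
              K * ((Nat.totient (Nat.card Γ) : ℝ) ^ 2 * Real.logb 2 (Nat.card Γ : ℝ)) ∧
            Real.exp (Real.logb 2 (Nat.card Γ : ℝ) *
                (c * min (Nat.totient (Nat.card Γ) : ℝ)
                  (Real.logb 2 (p : ℝ) / Real.logb 2 (Real.logb 2 (p : ℝ))))) ≤
              ((iteratedSumset n (subgroupSet Γ)).ncard : ℝ)) := by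
  refine ⟨2, two_pos, 1 / 256, by norm_num, fun p hp Γ ↦ ?_⟩
  have : Fact p.Prime := ⟨hp⟩
  exact ⟨fun C hC h1 h2 ↦ exists_iteratedSumset_of_card_le_rpow Γ hC h1 h2,
    exists_iteratedSumset_of_card_le_logb Γ⟩
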